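/- Let $m_{\mathrm c}\ge 1$ and $q\ge 1$ be integers and let $\alpha_1,\dots,\alpha_q\ge 1$ be (not necessarily distinct) integers. The instance $I=\{m_{\mathrm c},\{\alpha_i\}\}$ of the windows scheduling problem (with $m_{\mathrm c}$ channels and the $q$ symbols $1,\dots,q$) is called schedulable, written $I\in\mathrm{WSP}$, if there is an infinite sequence $C(1),C(2),\dots$ of ordered $m_{\mathrm c}$-tuples $C(t)=(c_1(t),\dots,c_{m_{\mathrm c}}(t))$ of elements of $\{1,\dots,q\}$ (repetitions within a tuple being allowed) such that, for every $i\in\{1,\dots,q\}$, among any $\alpha_i$ consecutive tuples there is at least one that contains the symbol $i$. The density of $I$ is $\rho(I)=\sum_{i=1}^q \frac1{\alpha_i}$. Then: 1. if $\rho(I)\le 0.75\,m_{\mathrm c}$, then $I\in\mathrm{WSP}$; 2. if $\rho(I)\le \frac56\,m_{\mathrm c}$ and $I$ has only three symbols, i.e. $q=3$, then $I\in\mathrm{WSP}$. -/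

import Mathlib

namespace WindowsScheduling

/-- The density of the window lengths `α 0, …, α (q - 1)`, that is `∑ i, 1 / α i`. -/
def density {q : ℕ} (α : Fin q → ℕ) : ℚ :=
  ∑ i, 1 / (α i : ℚ)

/-- A schedule with `m` channels over the `q` symbols `Fin q`: an infinite sequence of ordered
`m`-tuples of symbols; `C t k` is the symbol on channel `k` at time `t`. Nothing forbids a symbol
from occupying several channels at the same time, or from changing channel over time. -/
abbrev Schedule (m q : ℕ) : Type :=
  ℕ → Fin m → Fin q

/-- `C` is feasible for the window lengths `α` if every symbol `i` occurs in at least one tuple of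
every block `C t, …, C (t + α i - 1)` of `α i` consecutive tuples. -/
def Schedule.IsFeasible {m q : ℕ} (C : Schedule m q) (α : Fin q → ℕ) : Prop :=
  ∀ (i : Fin q) (t : ℕ), ∃ s : ℕ, t ≤ s ∧ s < t + α i ∧ ∃ k : Fin m, C s k = i

/-- The instance with `m` channels and window lengths `α` is accepted by the windows scheduling
problem: it has a feasible schedule. -/
def InWSP {q : ℕ} (m : ℕ) (α : Fin q → ℕ) : Prop :=
  ∃ C : Schedule m q, C.IsFeasible α

end WindowsScheduling

/-! Reading the channels in turn makes one channel with windows `m * α i` and density divided by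
`m`, so `m = 1` suffices. The bound 3/4 is proved by strong induction on the set of symbols,
according to the least window. Least window at most 12: for `p` symbols with windows at least `x`,
reserve `p` of every `x` slots; the other windows shrink by the factor `(x - p) / x`. If the
reserved windows are about `x`, the remaining density becomes about `(3/4 - p/x) / (1 - p/x) < 3/4`,
and this slack pays for rounding. A finite search finds such a reservation whatever the windows are.
Least window at least 13: round windows down to `x * 2 ^ e` or `z * 2 ^ e` with `x / z` near `√2`.
Such families pack with waste at most `1 / z` (`sched_two_rates`), and averaging over `z` gives a
choice with total at most 1. -/

namespace WindowsScheduling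

/-! ### Combining schedules on one channel. -/

/-- The symbols in `s` can share one channel: some sequence shows every `i ∈ s` in each block of
`α i` consecutive slots. -/
def Sched {ι : Type*} (s : Finset ι) (α : ι → ℕ) : Prop :=
  ∃ C : ℕ → ι, ∀ i ∈ s, ∀ t, ∃ n, t ≤ n ∧ n < t + α i ∧ C n = i

variable {ι : Type*}

theorem Sched.mono {s t : Finset ι} {α β : ι → ℕ} (h : Sched s α) (hts : t ⊆ s)
    (hαβ : ∀ i ∈ t, α i ≤ β i) : Sched t β := by
  obtain ⟨C, hC⟩ := h
  refine ⟨C, fun i hi u => ?_⟩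
  obtain ⟨n, h1, h2, h3⟩ := hC i (hts hi) u
  exact ⟨n, h1, h2.trans_le (Nat.add_le_add_left (hαβ i hi) u), h3⟩

theorem sched_empty [Nonempty ι] (α : ι → ℕ) : Sched ∅ α :=
  ⟨fun _ => Classical.arbitrary ι, by simp⟩

/-- A counter with steps `0` and `1` takes a step from every value it passes. -/
theorem exists_step {f : ℕ → ℕ} (hf : ∀ n, f (n + 1) ≤ f n + 1) {t a v : ℕ}
    (h1 : f t ≤ v) (h2 : v < f (t + a)) :
    ∃ n, t ≤ n ∧ n < t + a ∧ f n = v ∧ f (n + 1) = v + 1 := by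
  induction a with
  | zero => exact absurd h2 (not_lt.2 h1)
  | succ a ih =>
    by_cases h : v < f (t + a)
    · obtain ⟨n, hn1, hn2, hn3⟩ := ih h
      exact ⟨n, hn1, by omega, hn3⟩
    · have := hf (t + a)
      rw [← add_assoc] at h2
      exact ⟨t + a, by omega, by omega, by omega, by omega⟩

/-- Two streams of slots, of rates `r` and `1 - r`. -/
theorem Sched.union [DecidableEq ι] {A B : Finset ι} {α β γ : ι → ℕ} {r : ℚ} (hr0 : 0 ≤ r)
    (hr1 : r ≤ 1) (hA : Sched A β) (hB : Sched B γ)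
    (hAβ : ∀ i ∈ A, (β i : ℚ) ≤ r * α i) (hBγ : ∀ i ∈ B, (γ i : ℚ) ≤ (1 - r) * α i) :
    Sched (A ∪ B) α := by
  obtain ⟨CA, hCA⟩ := hA
  obtain ⟨CB, hCB⟩ := hB
  set N : ℕ → ℕ := fun t => ⌊r * t⌋₊ with hN
  have hN0 : ∀ t : ℕ, (0 : ℚ) ≤ r * t := fun t => by positivity
  have hNt : ∀ t, N t ≤ t := fun t => by
    have : N t ≤ ⌊(t : ℚ)⌋₊ :=
      Nat.floor_mono (mul_le_of_le_one_left (by positivity) hr1)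
    simpa using this
  have hmono : ∀ t, N t ≤ N (t + 1) := fun t =>
    Nat.floor_mono (mul_le_mul_of_nonneg_left (by push_cast; linarith) hr0)
  have hstep : ∀ t, N (t + 1) ≤ N t + 1 := fun t => by
    have h1 : r * ((t + 1 : ℕ) : ℚ) ≤ r * t + 1 := by push_cast; linarith
    have h2 := Nat.floor_mono h1
    rwa [Nat.floor_add_one (hN0 t)] at h2
  set M : ℕ → ℕ := fun t => t - N t with hM
  have hMstep : ∀ t, M (t + 1) ≤ M t + 1 := fun t => by
    have := hmono t; have := hNt t
    simp only [hM]; omega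
  refine ⟨fun t => if N (t + 1) = N t + 1 then CA (N t) else CB (M t), fun i hi t => ?_⟩
  rcases Finset.mem_union.1 hi with hi | hi
  · obtain ⟨v, hv1, hv2, hv3⟩ := hCA i hi (N t)
    have hge : N t + β i ≤ N (t + α i) := by
      have h1 : r * (t : ℚ) + (β i : ℕ) ≤ r * ((t + α i : ℕ) : ℚ) := by
        have := hAβ i hi
        push_cast; linarith
      have h2 := Nat.floor_mono h1
      rwa [Nat.floor_add_natCast (hN0 t)] at h2
    obtain ⟨n, hn1, hn2, hn3, hn4⟩ := exists_step hstep hv1 (hv2.trans_le hge)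
    refine ⟨n, hn1, hn2, ?_⟩
    exact (if_pos (by omega)).trans (by rw [hn3, hv3])
  · obtain ⟨v, hv1, hv2, hv3⟩ := hCB i hi (M t)
    have hle : γ i ≤ α i := by
      have h1 : (1 - r) * (α i : ℚ) ≤ α i :=
        mul_le_of_le_one_left (by positivity) (by linarith)
      exact_mod_cast (hBγ i hi).trans h1
    have hge : M t + γ i ≤ M (t + α i) := by
      have h1 : r * ((t + α i : ℕ) : ℚ) ≤ r * (t : ℚ) + (α i - γ i : ℕ) := by
        have := hBγ i hi
        push_cast [hle]; linarith
      have h2 := Nat.floor_mono h1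
      rw [Nat.floor_add_natCast (hN0 t)] at h2
      have h3 : N (t + α i) ≤ N t + (α i - γ i) := h2
      have := hNt t; have := hNt (t + α i)
      simp only [hM]; omega
    obtain ⟨n, hn1, hn2, hn3, hn4⟩ := exists_step hMstep hv1 (hv2.trans_le hge)
    refine ⟨n, hn1, hn2, ?_⟩
    have h5 : ¬ N (n + 1) = N n + 1 := by
      have := hNt n; have := hNt (n + 1)
      simp only [hM] at hn3 hn4; omega
    exact (if_neg h5).trans (by rw [hn3, hv3])

/-- One symbol's slots may be handed alternately to two symbols. -/
theorem Sched.merge [DecidableEq ι] {s : Finset ι} {α β : ι → ℕ} {i j : ι} (hij : i ≠ j)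
    (h : Sched (s.erase j) β) (hi : i ∈ s) (hαi : 2 * β i ≤ α i) (hαj : 2 * β i ≤ α j)
    (hα : ∀ l ∈ s, l ≠ i → l ≠ j → β l ≤ α l) : Sched s α := by
  obtain ⟨C, hC⟩ := h
  set N : ℕ → ℕ := fun t => Nat.count (fun n => C n = i) t with hN
  have hsucc : ∀ t, N (t + 1) = N t + if C t = i then 1 else 0 := fun t => Nat.count_succ _ _
  have hstep : ∀ t, N (t + 1) ≤ N t + 1 := fun t => by rw [hsucc]; split_ifs <;> omega
  have hmono : Monotone N := Nat.count_monotone _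
  have hone : ∀ t, N t + 1 ≤ N (t + β i) := fun t => by
    obtain ⟨n, h1, h2, h3⟩ := hC i (Finset.mem_erase.2 ⟨hij, hi⟩) t
    have h4 := hsucc n
    rw [if_pos h3] at h4
    have := hmono h1
    have := hmono (Nat.succ_le_of_lt h2)
    simp only [Nat.succ_eq_add_one] at *
    omega
  have key : ∀ t a b, 2 * β i ≤ a → b < 2 →
      ∃ n, t ≤ n ∧ n < t + a ∧ C n = i ∧ N n % 2 = b := fun t a b ha hb => by
    have h1 := hone t
    have h2 := hone (t + β i)
    have h3 := hmono (show t + β i + β i ≤ t + a by omega)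
    obtain ⟨n, hn1, hn2, hn3, hn4⟩ :=
      -- This value is `N t` or `N t + 1`, whichever has parity `b`; the counter passes both within
      -- two blocks of length `β i`.
      exists_step hstep (t := t) (a := a) (v := N t + (N t + b) % 2) (by omega) (by omega)
    refine ⟨n, hn1, hn2, ?_, by omega⟩
    by_contra hne
    have h4 := hsucc n
    rw [if_neg hne] at h4
    omega
  refine ⟨fun t => if C t = i then (if N t % 2 = 0 then i else j) else C t, fun l hl t => ?_⟩
  by_cases hli : l = i
  · subst hli
    obtain ⟨n, hn1, hn2, hn3, hn4⟩ := key t (α l) 0 hαi (by omega)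
    exact ⟨n, hn1, hn2, by simp [hn3, hn4]⟩
  by_cases hlj : l = j
  · subst hlj
    obtain ⟨n, hn1, hn2, hn3, hn4⟩ := key t (α l) 1 hαj (by omega)
    exact ⟨n, hn1, hn2, by simp [hn3, hn4]⟩
  · obtain ⟨n, hn1, hn2, hn3⟩ := hC l (Finset.mem_erase.2 ⟨hlj, hl⟩) t
    have := hα l hl hli hlj
    refine ⟨n, hn1, by omega, ?_⟩
    simp only [hn3, if_neg hli]

/-- Round robin. -/
theorem sched_of_card_le [Nonempty ι] [DecidableEq ι] {s : Finset ι} {α : ι → ℕ} {p : ℕ}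
    (hs : s.card ≤ p) (hα : ∀ i ∈ s, p ≤ α i) : Sched s α := by
  induction p generalizing s α with
  | zero =>
    rw [Finset.card_eq_zero.1 (Nat.le_zero.1 hs)]
    exact sched_empty α
  | succ p ih =>
    rcases s.eq_empty_or_nonempty with rfl | ⟨i, hi⟩
    · exact sched_empty α
    have hp : (0 : ℚ) < p + 1 := by positivity
    -- One symbol gets rate `1 / (p + 1)`; the other symbols share the rest with window `p`.
    have hB : Sched (s.erase i) (fun _ => p) :=
      ih (by rw [Finset.card_erase_of_mem hi]; omega) (fun _ _ => le_rfl)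
    have hA : Sched {i} (fun _ => 1) :=
      ⟨fun _ => i, fun l hl t => ⟨t, le_rfl, Nat.lt_succ_self t, (Finset.mem_singleton.1 hl).symm⟩⟩
    have hq : ∀ l ∈ s, (p + 1 : ℚ) ≤ α l := fun l hl => by exact_mod_cast hα l hl
    have h := Sched.union (α := α) (r := 1 / (p + 1 : ℚ)) (by positivity)
      (by rw [div_le_one hp]; linarith [(Nat.cast_nonneg p : (0 : ℚ) ≤ p)]) hA hB
      (fun l hl => by
        rw [Finset.mem_singleton.1 hl, div_mul_eq_mul_div, le_div_iff₀ hp]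
        have := hq i hi
        push_cast; linarith)
      (fun l hl => by
        rw [one_sub_div hp.ne', div_mul_eq_mul_div,
          le_div_iff₀ hp]
        have := hq l (Finset.mem_of_mem_erase hl)
        have h0 : (0 : ℚ) ≤ p := Nat.cast_nonneg p
        nlinarith)
    rwa [← Finset.insert_eq, Finset.insert_erase hi] at h

/-- Give every symbol of `A` one slot in `x` and schedule the rest in the remaining slots. -/
theorem sched_of_reserve [Nonempty ι] [DecidableEq ι] {A B : Finset ι} {α : ι → ℕ} {p x : ℕ}
    (hpx : p ≤ x) (hx : 0 < x) (hA : A.card ≤ p) (hAα : ∀ i ∈ A, x ≤ α i)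
    (hB : Sched B fun i => (x - p) * α i / x) : Sched (A ∪ B) α := by
  have hxq : (0 : ℚ) < x := by exact_mod_cast hx
  refine Sched.union (r := p / x) (β := fun _ => p) (by positivity)
    (by rw [div_le_one hxq]; exact_mod_cast hpx) (sched_of_card_le hA fun _ _ => le_rfl) hB
    (fun i hi => ?_) (fun i _ => ?_)
  · rw [div_mul_eq_mul_div, le_div_iff₀ hxq]
    exact mul_le_mul_of_nonneg_left (by exact_mod_cast hAα i hi) (by positivity)
  · rw [one_sub_div hxq.ne', div_mul_eq_mul_div]
    refine Nat.cast_div_le.trans (le_of_eq ?_)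
    push_cast [hpx]
    rfl

/-! ### The search for reservations. -/

/-- The unit of mass: a window `v` weighs about `unitMass / v`. -/
def unitMass : ℕ := 720720

/-- Three quarters of `unitMass`. -/
def massBound : ℕ := 540540

/-- Upper bound for the mass of the windows `c * v / x`, for `v` in the list. -/
def roomCost (c x : ℕ) : List ℕ → ℕ
  | [] => 0
  | v :: l => bif Nat.ble x (c * v) then unitMass / (c * v / x) + 1 + roomCost c x l
      -- This exceeds `massBound`, so a window that would shrink to 0 rules the reservation out.
      else unitMass

/-- For the `n` windows `a` from `b` on, `a * δ ≤ σ * (c * a / x)`. -/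
def tailFits (c x δ σ : ℕ) : ℕ → ℕ → Bool
  | 0, _ => true
  | n + 1, b => Nat.ble (b * δ) (σ * (c * b / x)) && tailFits c x δ σ n (b + 1)

/-- After `p` of every `x` slots are reserved, the windows in `pre` and `post`, together with
unknown windows of mass `δ` that are at least `b`, keep density at most `3 / 4`. -/
def closesWith (δ b p x : ℕ) (pre post : List ℕ) : Bool :=
  -- The first mass test is implied by the later one; it only rejects early.
  Nat.blt p x && (Nat.ble (x * δ) (massBound * (x - p)) &&
    (fun k => Nat.ble k massBound && (Nat.ble (x * δ) ((massBound - k) * (x - p)) &&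
      tailFits (x - p) x δ (massBound - k) x b))
      (roomCost (x - p) x pre + roomCost (x - p) x post))

/-- Search for a last window to reserve for. -/
def closesFrom (δ b : ℕ) (pre : List ℕ) : ℕ → List ℕ → Bool
  | _, [] => false
  | p, x :: post => closesWith δ b (p + 1) x pre post || closesFrom δ b pre (p + 1) post

/-- Search for a contiguous block of windows to reserve for. -/
def closes (δ b : ℕ) : List ℕ → List ℕ → Bool
  | _, [] => false
  | pre, x :: post => closesFrom δ b pre 0 (x :: post) || closes δ b (x :: pre) post

/-- Branch on whether the least unknown window is `b`. The known windows `P` are in descending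
order, and the unknown ones have mass at most `δ` and are at least `b`. -/
def search : ℕ → List ℕ → ℕ → ℕ → Bool
  | 0, _, _, _ => false
  | n + 1, P, δ, b => closes δ b [] P ||
      ((Nat.blt (δ * b) unitMass || search n (b :: P) (δ - unitMass / b) b) &&
        search n P δ (b + 1))

/-! ### Soundness of the search. -/

theorem unitMass_pos : (0 : ℚ) < unitMass := by norm_num [unitMass]

theorem massBound_eq : (massBound : ℚ) = 3 / 4 * unitMass := by norm_num [unitMass, massBound]

theorem roomCost_sound {c x : ℕ} (hx : 0 < x) {α : ι → ℕ} {l : List ι}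
    (h : roomCost c x (l.map α) ≤ massBound) :
    (∀ i ∈ l, 1 ≤ c * α i / x) ∧
      (l.map fun i => 1 / ((c * α i / x : ℕ) : ℚ)).sum * unitMass ≤ roomCost c x (l.map α) := by
  induction l with
  | nil => simp [roomCost]
  | cons i l ih =>
    simp only [List.map_cons, roomCost] at h ⊢
    cases hb : Nat.ble x (c * α i) with
    | false =>
      rw [hb] at h
      exact absurd h (by simp [unitMass, massBound])
    | true =>
      rw [hb] at h
      rw [cond_true] at h ⊢
      obtain ⟨h1, h2⟩ := ih ((Nat.le_add_left _ _).trans h)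
      have hf : 1 ≤ c * α i / x := (Nat.le_div_iff_mul_le hx).2 (by simpa using Nat.le_of_ble_eq_true hb)
      refine ⟨by simpa [hf] using h1, ?_⟩
      rw [List.sum_cons, add_mul]
      push_cast
      have hfq : (0 : ℚ) < ((c * α i / x : ℕ) : ℚ) := by exact_mod_cast hf
      have h3 : 1 / ((c * α i / x : ℕ) : ℚ) * unitMass
          ≤ ((unitMass / (c * α i / x) : ℕ) : ℚ) + 1 := by
        rw [div_mul_eq_mul_div, one_mul, div_le_iff₀ hfq]
        have := (Nat.lt_mul_div_succ unitMass hf).le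
        rw [mul_comm] at this
        exact_mod_cast this
      linarith

theorem tailFits_sound {c x δ σ n b : ℕ} (h : tailFits c x δ σ n b = true) {a : ℕ}
    (h1 : b ≤ a) (h2 : a < b + n) : a * δ ≤ σ * (c * a / x) := by
  induction n generalizing b with
  | zero => omega
  | succ n ih =>
    rw [tailFits, Bool.and_eq_true] at h
    rcases h1.eq_or_lt with rfl | h1
    · exact Nat.le_of_ble_eq_true h.1
    · exact ih h.2 h1 (by omega)

/-- Raising `a` by `x` adds `x * δ` on the left and `σ * c` on the right, so `x` consecutive values
decide all later ones. -/
theorem tailFits_forever {c x δ σ b : ℕ} (hx : 0 < x) (hs : x * δ ≤ σ * c)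
    (h : tailFits c x δ σ x b = true) {a : ℕ} (h1 : b ≤ a) : a * δ ≤ σ * (c * a / x) := by
  induction a using Nat.strong_induction_on with
  | _ a ih =>
    by_cases h2 : a < b + x
    · exact tailFits_sound h h1 h2
    · obtain ⟨d, rfl⟩ : ∃ d, a = d + x := ⟨a - x, by omega⟩
      have h3 := ih d (by omega) (by omega)
      rw [mul_add, Nat.add_mul_div_right _ _ hx, add_mul, mul_add]
      exact add_le_add h3 hs

/-- The theorem under proof, for fewer symbols than those in `s`. -/
def Below (s : Finset ι) : Prop :=
  ∀ t ⊂ s, ∀ β : ι → ℕ, (∀ i ∈ t, 1 ≤ β i) → ∑ i ∈ t, 1 / (β i : ℚ) ≤ 3 / 4 → Sched t β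

section Soundness

variable [DecidableEq ι] {s R : Finset ι} {α : ι → ℕ} {δ b : ℕ}

theorem closesWith_sound [Nonempty ι] (hs : Below s) (hα : ∀ i ∈ s, 1 ≤ α i)
    (hb : ∀ i ∈ R, b ≤ α i) (hδ : (∑ i ∈ R, 1 / (α i : ℚ)) * unitMass ≤ δ)
    {pre mid post : List ι} {x : ℕ} (hnd : (pre ++ (mid ++ post)).Nodup)
    (hdisj : Disjoint (pre ++ (mid ++ post)).toFinset R)
    (hunion : (pre ++ (mid ++ post)).toFinset ∪ R = s) (hmid : ∀ i ∈ mid, x ≤ α i)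
    (hne : mid ≠ []) (h : closesWith δ b mid.length x (pre.map α) (post.map α) = true) :
    Sched s α := by
  simp only [closesWith, Bool.and_eq_true] at h
  obtain ⟨hpx, -, hk, hx, ht⟩ := h
  replace hpx : mid.length < x := Nat.le_of_ble_eq_true hpx
  replace hk := Nat.le_of_ble_eq_true hk
  replace hx := Nat.le_of_ble_eq_true hx
  have hx0 : 0 < x := by omega
  obtain ⟨c, hc⟩ : ∃ c, c = x - mid.length := ⟨_, rfl⟩
  rw [← hc] at hk hx ht
  obtain ⟨hpre1, hpre2⟩ := roomCost_sound hx0 (c := c) (α := α) (l := pre) (by omega)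
  obtain ⟨hpost1, hpost2⟩ := roomCost_sound hx0 (c := c) (α := α) (l := post) (by omega)
  set k := roomCost c x (pre.map α) + roomCost c x (post.map α) with hkdef
  have hR : ∀ i ∈ R, 0 < α i ∧ 0 < δ ∧ 1 ≤ c * α i / x ∧
      α i * δ ≤ (massBound - k) * (c * α i / x) := fun i hi => by
    have hi0 : 0 < α i := hα i (hunion ▸ Finset.mem_union_right _ hi)
    have hδ0 : 0 < δ := by
      have h1 : 0 < ∑ i ∈ R, 1 / (α i : ℚ) :=
        Finset.sum_pos (fun j hj => by
          have := hα j (hunion ▸ Finset.mem_union_right _ hj)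
          positivity) ⟨i, hi⟩
      exact_mod_cast (mul_pos h1 unitMass_pos).trans_le hδ
    have h3 := tailFits_forever hx0 hx ht (hb i hi)
    -- The left side of `h3` is positive, so the shrunken window cannot be 0.
    exact ⟨hi0, hδ0, Nat.pos_of_mul_pos_left ((Nat.mul_pos hi0 hδ0).trans_le h3), h3⟩
  rw [List.nodup_append'] at hnd
  obtain ⟨hnd1, hnd2, hnd3⟩ := hnd
  rw [List.nodup_append'] at hnd2
  obtain ⟨hnd4, hnd5, hnd6⟩ := hnd2
  rw [List.disjoint_append_right] at hnd3
  simp only [List.toFinset_append, Finset.disjoint_union_left] at hdisj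
  set B := (pre.toFinset ∪ post.toFinset) ∪ R with hB
  have hAB : Disjoint mid.toFinset B := by
    simp only [hB, Finset.disjoint_union_right, List.disjoint_toFinset_iff_disjoint]
    exact ⟨⟨hnd3.1.symm, hnd6⟩, hdisj.2.1⟩
  have hsAB : mid.toFinset ∪ B = s := by
    rw [← hunion, hB]
    ext i
    simp only [Finset.mem_union, List.mem_toFinset, List.mem_append]
    tauto
  have hBs : B ⊂ s := by
    obtain ⟨i, hi⟩ := List.exists_mem_of_ne_nil _ hne
    have hi' := List.mem_toFinset.2 hi
    refine Finset.ssubset_iff_of_subset (hsAB ▸ Finset.subset_union_right) |>.2 ⟨i, ?_, ?_⟩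
    · exact hsAB ▸ Finset.mem_union_left _ hi'
    · exact Finset.disjoint_left.1 hAB hi'
  rw [← hsAB]
  refine sched_of_reserve hpx.le hx0 (List.toFinset_card_le _)
    (fun i hi => hmid i (List.mem_toFinset.1 hi)) (hs B hBs _ (fun i hi => ?_) ?_)
  · simp only [hB, Finset.mem_union, List.mem_toFinset] at hi
    rcases hi with (hi | hi) | hi
    exacts [hc ▸ hpre1 i hi, hc ▸ hpost1 i hi, hc ▸ (hR i hi).2.2.1]
  · simp only [← hc]
    rw [hB, Finset.sum_union (Finset.disjoint_union_left.2 ⟨hdisj.1, hdisj.2.2⟩),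
      Finset.sum_union (List.disjoint_toFinset_iff_disjoint.2 hnd3.2),
      List.sum_toFinset _ hnd1, List.sum_toFinset _ hnd5]
    have h4 : (∑ i ∈ R, 1 / ((c * α i / x : ℕ) : ℚ)) * unitMass ≤ massBound - k := by
      rcases R.eq_empty_or_nonempty with hR0 | ⟨i, hi⟩
      · rw [hR0, Finset.sum_empty, zero_mul, sub_nonneg]
        exact_mod_cast hk
      have hδ0 : (0 : ℚ) < δ := by exact_mod_cast (hR i hi).2.1
      have hkq : (k : ℚ) ≤ massBound := by exact_mod_cast hk
      -- Shrinking multiplies the weight of each unknown window by at most `(massBound - k) / δ`.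
      have h5 : ∑ i ∈ R, 1 / ((c * α i / x : ℕ) : ℚ)
          ≤ ∑ i ∈ R, (massBound - k) / δ * (1 / (α i : ℚ)) := by
        refine Finset.sum_le_sum fun j hj => ?_
        obtain ⟨h6, -, h7, h8⟩ := hR j hj
        have h6q : (0 : ℚ) < α j := by exact_mod_cast h6
        have h7q : (0 : ℚ) < ((c * α j / x : ℕ) : ℚ) := by exact_mod_cast h7
        have h8q : (α j : ℚ) * δ ≤ (massBound - k) * ((c * α j / x : ℕ) : ℚ) := by
          rw [← Nat.cast_sub hk]
          exact_mod_cast h8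
        rw [div_mul_div_comm, mul_one, div_le_div_iff₀ h7q (by positivity), one_mul]
        linarith
      rw [← Finset.mul_sum] at h5
      calc _ ≤ (massBound - k) / δ * (∑ i ∈ R, 1 / (α i : ℚ)) * unitMass :=
            mul_le_mul_of_nonneg_right h5 unitMass_pos.le
        _ ≤ (massBound - k) / δ * δ := by
            rw [mul_assoc]
            exact mul_le_mul_of_nonneg_left hδ (div_nonneg (by linarith) hδ0.le)
        _ = _ := div_mul_cancel₀ _ hδ0.ne'
    have hkq : (k : ℚ) = roomCost c x (pre.map α) + roomCost c x (post.map α) := by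
      rw [hkdef]; push_cast; rfl
    refine le_of_mul_le_mul_right ?_ unitMass_pos
    rw [← massBound_eq, add_mul, add_mul]
    linarith

theorem closesFrom_sound [Nonempty ι] (hs : Below s) (hα : ∀ i ∈ s, 1 ≤ α i)
    (hb : ∀ i ∈ R, b ≤ α i) (hδ : (∑ i ∈ R, 1 / (α i : ℚ)) * unitMass ≤ δ)
    {pre mid post : List ι} (hnd : (pre ++ (mid ++ post)).Nodup)
    (hdisj : Disjoint (pre ++ (mid ++ post)).toFinset R)
    (hunion : (pre ++ (mid ++ post)).toFinset ∪ R = s)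
    (hsort : (mid ++ post).Pairwise fun i j => α j ≤ α i)
    (h : closesFrom δ b (pre.map α) mid.length (post.map α) = true) : Sched s α := by
  induction post generalizing mid with
  | nil => simp [closesFrom] at h
  | cons i post ih =>
    have he : mid ++ i :: post = (mid ++ [i]) ++ post := by simp
    rw [he] at hnd hdisj hunion hsort
    rw [List.map_cons, closesFrom, Bool.or_eq_true] at h
    have hl : mid.length + 1 = (mid ++ [i]).length := by simp
    rw [hl] at h
    rcases h with h | h
    · refine closesWith_sound hs hα hb hδ hnd hdisj hunion (fun j hj => ?_) (by simp) h
      rw [List.mem_append, List.mem_singleton] at hj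
      rcases hj with hj | rfl
      · exact (List.pairwise_append.1 (List.pairwise_append.1 hsort).1).2.2 j hj i (by simp)
      · exact le_rfl
    · exact ih hnd hdisj hunion hsort h

theorem closes_sound [Nonempty ι] (hs : Below s) (hα : ∀ i ∈ s, 1 ≤ α i)
    (hb : ∀ i ∈ R, b ≤ α i) (hδ : (∑ i ∈ R, 1 / (α i : ℚ)) * unitMass ≤ δ)
    {pre post : List ι} (hnd : (pre ++ post).Nodup)
    (hdisj : Disjoint (pre ++ post).toFinset R) (hunion : (pre ++ post).toFinset ∪ R = s)
    (hsort : post.Pairwise fun i j => α j ≤ α i)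
    (h : closes δ b (pre.map α) (post.map α) = true) : Sched s α := by
  induction post generalizing pre with
  | nil => simp [closes] at h
  | cons i post ih =>
    rw [List.map_cons, closes, Bool.or_eq_true] at h
    rcases h with h | h
    · exact closesFrom_sound hs hα hb hδ (mid := []) hnd hdisj hunion hsort h
    · have hp : (i :: pre ++ post).Perm (pre ++ i :: post) := List.perm_middle.symm
      rw [← hp.nodup_iff] at hnd
      rw [← List.toFinset_eq_of_perm _ _ hp] at hdisj hunion
      exact ih hnd hdisj hunion hsort.of_cons h

/-- `δ` stays an upper bound because the mass `unitMass / b` taken off for a discovered window is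
rounded down. -/
theorem search_sound [Nonempty ι] (hs : Below s) (hα : ∀ i ∈ s, 1 ≤ α i) {n : ℕ}
    (hb : ∀ i ∈ R, b ≤ α i) (hδ : (∑ i ∈ R, 1 / (α i : ℚ)) * unitMass ≤ δ)
    {L : List ι} (hnd : L.Nodup) (hdisj : Disjoint L.toFinset R) (hunion : L.toFinset ∪ R = s)
    (hsort : L.Pairwise fun i j => α j ≤ α i) (hLb : ∀ i ∈ L, α i ≤ b)
    (h : search n (L.map α) δ b = true) : Sched s α := by
  induction n generalizing L R δ b with
  | zero => simp [search] at h
  | succ n ih =>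
    simp only [search, Bool.or_eq_true, Bool.and_eq_true] at h
    rcases h with h | ⟨h1, h2⟩
    · exact closes_sound hs hα hb hδ (pre := []) hnd hdisj hunion hsort h
    by_cases hex : ∃ i ∈ R, α i = b
    · obtain ⟨i, hi, rfl⟩ := hex
      have hi0 : 0 < α i := hα i (hunion ▸ Finset.mem_union_right _ hi)
      have hi0q : (0 : ℚ) < α i := by exact_mod_cast hi0
      have hsplit := Finset.add_sum_erase R (fun i => 1 / (α i : ℚ)) hi
      have hnn : 0 ≤ ∑ i ∈ R.erase i, 1 / (α i : ℚ) :=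
        Finset.sum_nonneg fun j _ => by positivity
      have hU := unitMass_pos
      have hiδ : 1 / (α i : ℚ) * unitMass ≤ δ := by
        refine le_trans (mul_le_mul_of_nonneg_right ?_ hU.le) hδ
        linarith
      have hle : unitMass ≤ δ * α i := by
        rw [div_mul_eq_mul_div, one_mul, div_le_iff₀ hi0q] at hiδ
        exact_mod_cast hiδ
      -- In the first case a window `b` alone would outweigh `δ`.
      rcases h1 with h1 | h1
      · have : δ * α i < unitMass := Nat.le_of_ble_eq_true h1
        omega
      refine ih (R := R.erase i) (L := i :: L) (fun j hj => hb j (Finset.mem_of_mem_erase hj))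
        ?_ ?_ ?_ ?_ ?_ ?_ h1
      · have h3 : ((unitMass / α i : ℕ) : ℚ) ≤ 1 / (α i : ℚ) * unitMass := by
          rw [div_mul_eq_mul_div, one_mul]
          exact Nat.cast_div_le
        have h4 : unitMass / α i ≤ δ := by exact_mod_cast h3.trans hiδ
        rw [← hsplit, add_mul] at hδ
        push_cast [h4]
        linarith
      · exact List.nodup_cons.2
          ⟨fun hiL => Finset.disjoint_left.1 hdisj (List.mem_toFinset.2 hiL) hi, hnd⟩
      · rw [List.toFinset_cons, Finset.disjoint_insert_left]
        exact ⟨Finset.notMem_erase _ _, hdisj.mono_right (Finset.erase_subset _ _)⟩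
      · rw [List.toFinset_cons, Finset.insert_union, ← Finset.union_insert,
          Finset.insert_erase hi, hunion]
      · exact List.pairwise_cons.2 ⟨hLb, hsort⟩
      · simpa using hLb
    · refine ih (fun j hj => ?_) hδ hnd hdisj hunion hsort
        (fun j hj => (hLb j hj).trans (Nat.le_succ b)) h2
      have h3 := hb j hj
      exact Nat.lt_of_le_of_ne h3 fun h4 => hex ⟨j, hj, h4.symm⟩

end Soundness

/-- The fuel 80 bounds the depth: each step down either adds a known window or raises `b`. -/
theorem search_two_to_twelve :
    ∀ k < 13, 2 ≤ k → search 80 [k] (massBound - unitMass / k) k = true := by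
  decide +kernel

/-- If the least window is at most `12`, fewer symbols are enough to consider. -/
theorem sched_of_small_min [Nonempty ι] [DecidableEq ι] {s : Finset ι} {α : ι → ℕ} (hs : Below s)
    (hsum : ∑ i ∈ s, 1 / (α i : ℚ) ≤ 3 / 4) {i : ι} (hi : i ∈ s) (hmin : ∀ j ∈ s, α i ≤ α j)
    (h2 : 1 ≤ α i) (h13 : α i < 13) : Sched s α := by
  have hα : ∀ j ∈ s, 1 ≤ α j := fun j hj => h2.trans (hmin j hj)
  have hi0q : (0 : ℚ) < α i := by exact_mod_cast h2
  have hsplit := Finset.add_sum_erase s (fun i => 1 / (α i : ℚ)) hi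
  have hnn : 0 ≤ ∑ i ∈ s.erase i, 1 / (α i : ℚ) :=
    Finset.sum_nonneg fun j _ => by positivity
  have hU := unitMass_pos
  have hi2 : 2 ≤ α i := by
    by_contra hlt
    have h1 : α i = 1 := by omega
    simp only [h1, Nat.cast_one] at hsplit
    linarith
  refine search_sound hs hα (R := s.erase i) (L := [i])
    (fun j hj => hmin j (Finset.mem_of_mem_erase hj)) ?_ (by simp) (by simp)
    (by simp [Finset.insert_erase hi]) (by simp) (by simp)
    (search_two_to_twelve (α i) h13 hi2)
  have h3 : ((unitMass / α i : ℕ) : ℚ) ≤ 1 / (α i : ℚ) * unitMass := by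
    rw [div_mul_eq_mul_div, one_mul]
    exact Nat.cast_div_le
  have h4 : unitMass / α i ≤ massBound := by
    have : unitMass / α i ≤ unitMass / 2 := Nat.div_le_div_left hi2 (by norm_num)
    exact this.trans (by norm_num [unitMass, massBound])
  have h5 := mul_le_mul_of_nonneg_right hsum hU.le
  rw [← hsplit, add_mul, ← massBound_eq] at h5
  push_cast [h4]
  linarith

/-! ### Packing windows that are multiples of powers of two. -/

theorem sum_two_pow_sub {s : Finset ι} {e : ι → ℕ} {J : ℕ} (hJ : ∀ i ∈ s, e i ≤ J) :
    ((∑ i ∈ s, 2 ^ (J - e i) : ℕ) : ℚ) = (∑ i ∈ s, 1 / (2 : ℚ) ^ e i) * 2 ^ J := by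
  push_cast
  rw [Finset.sum_mul]
  refine Finset.sum_congr rfl fun i hi => ?_
  rw [pow_sub₀ _ two_ne_zero (hJ i hi)]
  ring

/-- Symbols on the finest level are merged in pairs into one symbol a level up, until `p` slots at
level 0 suffice. -/
theorem sched_dyadic_aux [Nonempty ι] [DecidableEq ι] {p J : ℕ} {s : Finset ι} {e : ι → ℕ}
    (hJ : ∀ i ∈ s, e i ≤ J) (hs : ∑ i ∈ s, 2 ^ (J - e i) ≤ p * 2 ^ J) :
    Sched s fun i => p * 2 ^ e i := by
  induction J generalizing s e with
  | zero =>
    refine sched_of_card_le (p := p) ?_ fun i _ => Nat.le_mul_of_pos_right p (by positivity)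
    simpa using hs
  | succ J ih =>
    induction hn : (s.filter fun i => e i = J + 1).card using Nat.strong_induction_on
      generalizing s e with
    | _ n ihn =>
      have hdouble : ∀ t : Finset ι, (∀ i ∈ t, e i ≤ J) →
          ∑ i ∈ t, 2 ^ (J + 1 - e i) = 2 * ∑ i ∈ t, 2 ^ (J - e i) := fun t ht => by
        rw [Finset.mul_sum]
        refine Finset.sum_congr rfl fun i hi => ?_
        rw [Nat.sub_add_comm (ht i hi), pow_succ']
      rcases (s.filter fun i => e i = J + 1).eq_empty_or_nonempty with h0 | ⟨i, hiT⟩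
      · have hle : ∀ i ∈ s, e i ≤ J := fun i hi => by
          have h1 := hJ i hi
          have h2 := Finset.filter_eq_empty_iff.1 h0 hi
          omega
        refine ih hle ?_
        rw [hdouble s hle, pow_succ'] at hs
        linarith
      obtain ⟨hi, hie⟩ := Finset.mem_filter.1 hiT
      have hupd : ∀ t : Finset ι, i ∉ t → ∀ K,
          ∑ l ∈ t, 2 ^ (K - Function.update e i J l) = ∑ l ∈ t, 2 ^ (K - e l) :=
        fun t ht K => Finset.sum_congr rfl fun l hl => by
          rw [Function.update_of_ne (by rintro rfl; exact ht hl)]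
      rw [← Finset.add_sum_erase s _ hi, hie, Nat.sub_self, pow_zero] at hs
      by_cases h1 : ∃ j ∈ s, j ≠ i ∧ e j = J + 1
      · obtain ⟨j, hj, hji, hje⟩ := h1
        have hj' : j ∈ s.erase i := Finset.mem_erase.2 ⟨hji, hj⟩
        have hi' : i ∈ s.erase j := Finset.mem_erase.2 ⟨hji.symm, hi⟩
        rw [← Finset.add_sum_erase _ _ hj', hje, Nat.sub_self, pow_zero] at hs
        have hrec : Sched (s.erase j) fun l => p * 2 ^ Function.update e i J l := by
          refine ihn _ ?_ (fun l hl => ?_) ?_ rfl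
          · rw [← hn]
            refine Finset.card_lt_card (Finset.ssubset_iff_of_subset (fun l hl => ?_) |>.2
              ⟨i, hiT, by simp⟩)
            obtain ⟨hl1, hl2⟩ := Finset.mem_filter.1 hl
            have hli : l ≠ i := by
              rintro rfl
              simp at hl2
            rw [Function.update_of_ne hli] at hl2
            exact Finset.mem_filter.2 ⟨Finset.mem_of_mem_erase hl1, hl2⟩
          · by_cases hli : l = i
            · subst hli; simp
            · rw [Function.update_of_ne hli]
              exact hJ l (Finset.mem_of_mem_erase hl)
          · rw [← Finset.add_sum_erase _ _ hi', hupd _ (Finset.notMem_erase _ _),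
              Finset.erase_right_comm, Function.update_self, Nat.add_sub_cancel_left]
            linarith
        refine hrec.merge hji.symm hi ?_ ?_ fun l _ hli _ => by rw [Function.update_of_ne hli]
        · simp only [Function.update_self, hie, pow_succ']
          exact le_of_eq (by ring)
        · simp only [Function.update_self, hje, pow_succ']
          exact le_of_eq (by ring)
      · push Not at h1
        have hle : ∀ l ∈ s.erase i, e l ≤ J := fun l hl => by
          have h2 := hJ l (Finset.mem_of_mem_erase hl)
          have h3 := h1 l (Finset.mem_of_mem_erase hl) (Finset.ne_of_mem_erase hl)
          omega
        -- A lone symbol on the finest level moves up too: the bound and the other terms are even,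
        -- so there is room for one more unit.
        have hrec : Sched s fun l => p * 2 ^ Function.update e i J l := by
          refine ih (fun l hl => ?_) ?_
          · by_cases hli : l = i
            · subst hli; simp
            · rw [Function.update_of_ne hli]
              exact hle l (Finset.mem_erase.2 ⟨hli, hl⟩)
          · rw [← Finset.add_sum_erase _ _ hi, hupd _ (Finset.notMem_erase _ _),
              Function.update_self, Nat.sub_self, pow_zero]
            rw [hdouble _ hle, pow_succ', mul_left_comm] at hs
            omega
        refine hrec.mono subset_rfl fun l _ => Nat.mul_le_mul_left p
          (Nat.pow_le_pow_right two_pos ?_)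
        by_cases hli : l = i
        · subst hli; rw [Function.update_self]; omega
        · rw [Function.update_of_ne hli]

/-- Windows `p * 2 ^ e` of total density at most one. -/
theorem sched_dyadic [Nonempty ι] [DecidableEq ι] {p : ℕ} {s : Finset ι} {e : ι → ℕ}
    (hs : ∑ i ∈ s, 1 / (2 : ℚ) ^ e i ≤ p) : Sched s fun i => p * 2 ^ e i := by
  have hJ : ∀ i ∈ s, e i ≤ s.sup e := fun i hi => Finset.le_sup hi
  refine sched_dyadic_aux hJ ?_
  have h := mul_le_mul_of_nonneg_right hs (show (0 : ℚ) ≤ 2 ^ s.sup e by positivity)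
  rw [← sum_two_pow_sub hJ] at h
  exact_mod_cast h

/-- Powers of `1 / 2` of sum at least `p` have a subfamily of sum `p`. -/
theorem exists_subset_sum_eq [DecidableEq ι] {p : ℕ} {s : Finset ι} {e : ι → ℕ}
    (hs : (p : ℚ) ≤ ∑ i ∈ s, 1 / (2 : ℚ) ^ e i) :
    ∃ t ⊆ s, ∑ i ∈ t, 1 / (2 : ℚ) ^ e i = p := by
  induction hn : s.card generalizing s with
  | zero =>
    refine ⟨s, subset_rfl, ?_⟩
    rw [Finset.card_eq_zero.1 hn, Finset.sum_empty] at hs ⊢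
    exact le_antisymm (Nat.cast_nonneg p) hs
  | succ n ih =>
    rcases hs.eq_or_lt with heq | hlt
    · exact ⟨s, subset_rfl, heq.symm⟩
    -- All terms and `p` are multiples of the smallest term, so a sum above `p` stays at least `p`
    -- when that term is dropped.
    obtain ⟨i, hi, hmax⟩ := Finset.exists_max_image s e (Finset.card_pos.1 (by omega))
    have hpos : (0 : ℚ) < 2 ^ e i := by positivity
    have h1 := mul_lt_mul_of_pos_right hlt hpos
    rw [← sum_two_pow_sub hmax] at h1
    have h2 : p * 2 ^ e i + 1 ≤ ∑ l ∈ s, 2 ^ (e i - e l) := by exact_mod_cast h1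
    have h3 : (p * 2 ^ e i + 1 : ℚ) ≤ (∑ l ∈ s, 1 / (2 : ℚ) ^ e l) * 2 ^ e i := by
      rw [← sum_two_pow_sub hmax]
      exact_mod_cast h2
    have h4 : (p : ℚ) ≤ ∑ l ∈ s.erase i, 1 / (2 : ℚ) ^ e l := by
      rw [← Finset.add_sum_erase s _ hi, add_mul, div_mul_cancel₀ _ hpos.ne'] at h3
      exact le_of_mul_le_mul_right (by linarith) hpos
    obtain ⟨t, ht, hsum⟩ := ih h4 (by rw [Finset.card_erase_of_mem hi, hn]; rfl)
    exact ⟨t, ht.trans (Finset.erase_subset _ _), hsum⟩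

/-- At rate `p / x` a window `2 ^ e * x` becomes the integer `p * 2 ^ e`, so the bases may be
arbitrary rationals. -/
theorem sched_units [Nonempty ι] [DecidableEq ι] {A B : Finset ι} {α e : ι → ℕ} {x z : ℚ}
    (hx : 0 < x) (hz : 0 < z) {p q : ℕ} (hA : ∀ i ∈ A, 2 ^ e i * x ≤ α i)
    (hB : ∀ i ∈ B, 2 ^ e i * z ≤ α i) (hp : ∑ i ∈ A, 1 / (2 : ℚ) ^ e i ≤ p)
    (hq : ∑ i ∈ B, 1 / (2 : ℚ) ^ e i ≤ q) (hpq : p / x + q / z ≤ 1) : Sched (A ∪ B) α := by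
  have hpx : (0 : ℚ) ≤ p / x := by positivity
  have hqz : (0 : ℚ) ≤ q / z := by positivity
  refine Sched.union (r := p / x) hpx (by linarith) (sched_dyadic hp) (sched_dyadic hq)
    (fun i hi => ?_) (fun i hi => ?_)
  · refine le_trans (le_of_eq ?_) (mul_le_mul_of_nonneg_left (hA i hi) hpx)
    push_cast
    field_simp
  · refine le_trans (le_of_eq ?_) ((mul_le_mul_of_nonneg_left (hB i hi) hqz).trans
      (mul_le_mul_of_nonneg_right (by linarith) (by positivity)))
    push_cast
    field_simp

/-- Two specializations, `x * 2 ^ e` on `A` and `z * 2 ^ e` on `B`, waste at most `1 / z`. -/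
theorem sched_two_rates [Nonempty ι] [DecidableEq ι] {A B : Finset ι} {α e : ι → ℕ} {x z : ℚ}
    (hz : 0 < z) (hzx : z ≤ x) (hAB : Disjoint A B) (hA : ∀ i ∈ A, 2 ^ e i * x ≤ α i)
    (hB : ∀ i ∈ B, 2 ^ e i * z ≤ α i)
    (hsum : (∑ i ∈ A, 1 / (2 : ℚ) ^ e i) / x + (∑ i ∈ B, 1 / (2 : ℚ) ^ e i) / z + 1 / z ≤ 1) :
    Sched (A ∪ B) α := by
  have hx : 0 < x := hz.trans_le hzx
  set a := ∑ i ∈ A, 1 / (2 : ℚ) ^ e i with ha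
  set b := ∑ i ∈ B, 1 / (2 : ℚ) ^ e i with hb
  have ha0 : 0 ≤ a := Finset.sum_nonneg fun i _ => by positivity
  have hb0 : 0 ≤ b := Finset.sum_nonneg fun i _ => by positivity
  have hafl := Nat.floor_le ha0
  have hbfl := Nat.floor_le hb0
  -- If the fractional parts add up to at most 1, the surplus of `A` moves to the smaller base and
  -- only `b` is rounded up. Otherwise rounding both up wastes less than `1 / z`.
  by_cases hfg : a - ⌊a⌋₊ + (b - ⌊b⌋₊) ≤ 1
  · obtain ⟨t, ht, htsum⟩ := exists_subset_sum_eq hafl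
    have hsd := Finset.sum_sdiff (f := fun i => 1 / (2 : ℚ) ^ e i) ht
    have hunion : A ∪ B = t ∪ ((A \ t) ∪ B) := by
      rw [← Finset.union_assoc, Finset.union_sdiff_of_subset ht]
    rw [hunion]
    refine sched_units hx hz (p := ⌊a⌋₊) (q := ⌊b⌋₊ + 1) (fun i hi => hA i (ht hi))
      (fun i hi => ?_) htsum.le ?_ ?_
    · rcases Finset.mem_union.1 hi with hi | hi
      · exact (mul_le_mul_of_nonneg_left hzx (by positivity)).trans
          (hA i (Finset.sdiff_subset hi))
      · exact hB i hi
    · rw [Finset.sum_union (hAB.mono_left Finset.sdiff_subset)]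
      push_cast
      linarith
    · have h1 := div_le_div_of_nonneg_right hafl hx.le
      have h2 := div_le_div_of_nonneg_right hbfl hz.le
      push_cast
      rw [add_div]
      linarith
  · push Not at hfg
    refine sched_units hx hz (p := ⌊a⌋₊ + 1) (q := ⌊b⌋₊ + 1) hA hB
      (by push_cast; exact (Nat.lt_floor_add_one a).le)
      (by push_cast; exact (Nat.lt_floor_add_one b).le) ?_
    have hf : 0 ≤ ⌊a⌋₊ + 1 - a := by linarith [Nat.lt_floor_add_one a]
    have h1 : (⌊a⌋₊ + 1 - a) / x ≤ (⌊a⌋₊ + 1 - a) / z := div_le_div_of_nonneg_left hf hz hzx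
    have h2 : (⌊a⌋₊ + 1 - a + (⌊b⌋₊ + 1 - b)) / z ≤ 1 / z :=
      div_le_div_of_nonneg_right (by linarith) hz.le
    push_cast
    simp only [add_div, sub_div] at *
    linarith

/-! ### Choosing the two bases by averaging. -/

/-- The cost of a window in cell `l`, of length about `l / 90` times the least window, when the
bases are `Z` and `17 * Z / 12`. -/
def cellCost (l Z : ℕ) : ℚ :=
  if 2 * Z ≤ l then 1 / (2 * Z : ℕ) else if 17 * Z / 12 ≤ l then 1 / (17 * Z / 12 : ℕ) else 1 / Z

/-- A window in cell `l` is at most `l + 1` units long, so rounding inflates its weight by at most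
31.51 / 26 on average over the 26 values of `Z`. These run over about one factor `√2`, after which
the pairs of bases nearly repeat. -/
theorem sum_cellCost_le : ∀ l < 180, 90 ≤ l →
    (∑ Z ∈ Finset.Icc 65 90, cellCost l Z) * (l + 1) ≤ 3151 / 100 := by
  decide +kernel

theorem sum_inv_base_le : (∑ Z ∈ Finset.Icc (65 : ℕ) 90, 90 / (Z : ℚ)) ≤ 3049 / 100 := by
  decide +kernel

/-- Windows of density at most `3 / 4` that are all at least `13`. -/
theorem sched_of_large_min [Nonempty ι] [DecidableEq ι] {s : Finset ι} {α : ι → ℕ} {k : ℕ}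
    (hk : 13 ≤ k) (hα : ∀ i ∈ s, k ≤ α i) (hsum : ∑ i ∈ s, 1 / (α i : ℚ) ≤ 3 / 4) :
    Sched s α := by
  have hk0 : (0 : ℚ) < k := by exact_mod_cast (show 0 < k by omega)
  -- `j i` is the octave of the window above `k`, and `l i` its cell when the octave is cut into 90
  -- equal cells.
  set j : ι → ℕ := fun i => Nat.log 2 (α i / k) with hj
  set l : ι → ℕ := fun i => 90 * α i / (k * 2 ^ j i) with hl
  have hkj : ∀ i, 0 < k * 2 ^ j i := fun i => Nat.mul_pos (by omega) (by positivity)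
  have hl1 : ∀ i ∈ s, 90 ≤ l i := fun i hi => by
    have h1 : 2 ^ j i ≤ α i / k :=
      Nat.pow_log_le_self 2 (Nat.div_pos (hα i hi) (by omega)).ne'
    have h2 := (Nat.le_div_iff_mul_le (by omega)).1 h1
    refine (Nat.le_div_iff_mul_le (hkj i)).2 ?_
    linarith
  have hl2 : ∀ i, l i < 180 := fun i => by
    have h1 : α i / k < 2 ^ (j i + 1) := Nat.lt_pow_succ_log_self one_lt_two _
    have h2 := (Nat.div_lt_iff_lt_mul (by omega)).1 h1
    refine (Nat.div_lt_iff_lt_mul (hkj i)).2 ?_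
    rw [pow_succ] at h2
    linarith
  have hl3 : ∀ i, (l i : ℚ) * (k * 2 ^ j i) ≤ 90 * α i := fun i => by
    exact_mod_cast Nat.div_mul_le_self (90 * α i) (k * 2 ^ j i)
  have hl4 : ∀ i, 90 * (α i : ℚ) ≤ (l i + 1) * (k * 2 ^ j i) := fun i => by
    have := (Nat.lt_mul_div_succ (90 * α i) (hkj i)).le
    rw [mul_comm (k * 2 ^ j i)] at this
    exact_mod_cast this
  obtain ⟨Z, hZ, hcost⟩ : ∃ Z ∈ Finset.Icc 65 90,
      ∑ i ∈ s, 90 / (k * 2 ^ j i) * cellCost (l i) Z + 90 / (Z * k) ≤ 1 := by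
    by_contra hno
    push Not at hno
    have h1 : ∑ _Z ∈ Finset.Icc (65 : ℕ) 90, (1 : ℚ) < ∑ Z ∈ Finset.Icc 65 90,
        (∑ i ∈ s, 90 / (k * 2 ^ j i) * cellCost (l i) Z + 90 / (Z * k)) :=
      Finset.sum_lt_sum_of_nonempty ⟨65, by simp⟩ hno
    rw [Finset.sum_add_distrib, Finset.sum_comm] at h1
    have h2 : ∑ i ∈ s, ∑ Z ∈ Finset.Icc 65 90, 90 / ((k : ℚ) * 2 ^ j i) * cellCost (l i) Z
        ≤ ∑ i ∈ s, 3151 / 100 * (1 / (α i : ℚ)) := by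
      refine Finset.sum_le_sum fun i hi => ?_
      rw [← Finset.mul_sum]
      have h3 := sum_cellCost_le (l i) (hl2 i) (hl1 i hi)
      have h4 : (0 : ℚ) < k * 2 ^ j i := by positivity
      have h5 : (0 : ℚ) < α i := by exact_mod_cast (show 0 < α i by have := hα i hi; omega)
      have h6 : (0 : ℚ) < l i + 1 := by positivity
      rw [← le_div_iff₀ h6] at h3
      refine (mul_le_mul_of_nonneg_left h3 (by positivity)).trans ?_
      rw [div_mul_div_comm, mul_one_div, div_le_div_iff₀ (by positivity) h5]
      have := hl4 i
      linarith
    rw [← Finset.mul_sum] at h2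
    have h3 : ∑ Z ∈ Finset.Icc (65 : ℕ) 90, 90 / ((Z : ℚ) * k) ≤ 3049 / 100 / 13 := by
      have h4 : ∑ Z ∈ Finset.Icc (65 : ℕ) 90, 90 / ((Z : ℚ) * k)
          = (∑ Z ∈ Finset.Icc (65 : ℕ) 90, 90 / (Z : ℚ)) / k := by
        rw [Finset.sum_div]
        exact Finset.sum_congr rfl fun Z _ => by rw [div_div]
      rw [h4]
      exact div_le_div₀ (by norm_num) sum_inv_base_le (by norm_num) (by exact_mod_cast hk)
    have h4 : ∑ _Z ∈ Finset.Icc (65 : ℕ) 90, (1 : ℚ) = 26 := by simp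
    -- 31.51 * 3/4 + 30.49 / 13 is about 25.98, below 26; with 12 in place of 13 this would fail.
    linarith
  obtain ⟨hZ1, hZ2⟩ := Finset.mem_Icc.1 hZ
  have hZ0 : (0 : ℚ) < Z := by exact_mod_cast (show 0 < Z by omega)
  set X := 17 * Z / 12 with hX
  have hXZ : Z ≤ X := by omega
  have hX0 : (0 : ℚ) < X := by exact_mod_cast (show 0 < X by omega)
  -- From `2 * Z` on, the best base is `Z` one octave higher.
  set e : ι → ℕ := fun i => if 2 * Z ≤ l i then j i + 1 else j i with he
  have hfit : ∀ (i : ι) (W : ℕ), W ≤ l i → 2 ^ j i * ((W : ℚ) * k / 90) ≤ α i := fun i W hW => by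
    have h1 : (W : ℚ) * (k * 2 ^ j i) ≤ l i * (k * 2 ^ j i) :=
      mul_le_mul_of_nonneg_right (by exact_mod_cast hW) (by positivity)
    have := hl3 i
    linarith
  have hs := sched_two_rates (A := s.filter fun i => ¬ 2 * Z ≤ l i ∧ X ≤ l i)
    (B := s.filter fun i => ¬ (¬ 2 * Z ≤ l i ∧ X ≤ l i)) (α := α) (e := e)
    (x := X * k / 90) (z := Z * k / 90) (by positivity)
    (by gcongr) (Finset.disjoint_filter_filter_not _ _ _)
    (fun i hi => by
      obtain ⟨-, h1, h2⟩ := Finset.mem_filter.1 hi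
      simp only [he, if_neg h1]
      exact hfit i X h2)
    (fun i hi => by
      obtain ⟨his, -⟩ := Finset.mem_filter.1 hi
      simp only [he]
      split_ifs with h1
      · have := hfit i (2 * Z) h1
        push_cast at this
        rw [pow_succ]
        linarith
      · exact hfit i Z (by have := hl1 i his; omega))
    (by
      refine le_trans (le_of_eq ?_) hcost
      rw [← Finset.sum_filter_add_sum_filter_not s (fun i => ¬ 2 * Z ≤ l i ∧ X ≤ l i)
        (fun i => 90 / ((k : ℚ) * 2 ^ j i) * cellCost (l i) Z), Finset.sum_div, Finset.sum_div]
      congr 1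
      · congr 1
        · refine Finset.sum_congr rfl fun i hi => ?_
          obtain ⟨-, h1, h2⟩ := Finset.mem_filter.1 hi
          simp only [he, cellCost, if_neg h1, ← hX, if_pos h2]
          field_simp
        · refine Finset.sum_congr rfl fun i hi => ?_
          obtain ⟨-, h1⟩ := Finset.mem_filter.1 hi
          by_cases h2 : 2 * Z ≤ l i
          · simp only [he, cellCost, if_pos h2]
            push_cast
            field_simp
            rw [pow_succ]
          · have h3 : ¬ X ≤ l i := fun h => h1 ⟨h2, h⟩
            simp only [he, cellCost, if_neg h2, ← hX, if_neg h3]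
            field_simp
      · field_simp)
  rwa [Finset.filter_union_filter_not_eq] at hs

/-- Windows of density at most `3 / 4` can be scheduled. -/
theorem sched_of_density_le [Nonempty ι] [DecidableEq ι] (s : Finset ι) (α : ι → ℕ)
    (hα : ∀ i ∈ s, 1 ≤ α i) (hsum : ∑ i ∈ s, 1 / (α i : ℚ) ≤ 3 / 4) : Sched s α := by
  induction s using Finset.strongInduction generalizing α with
  | H s ih =>
    rcases s.eq_empty_or_nonempty with rfl | hne
    · exact sched_empty α
    obtain ⟨i, hi, hmin⟩ := Finset.exists_min_image s α hne
    by_cases h : α i < 13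
    · exact sched_of_small_min ih hsum hi hmin (hα i hi) h
    · exact sched_of_large_min (not_lt.1 h) hmin hsum

/-! ### Several channels, and three symbols. -/

/-- Channel `k` at time `t` is slot `m * t + k`, so `α i` consecutive tuples are `m * α i`
consecutive slots. -/
theorem InWSP.of_sched {m q : ℕ} {α : Fin q → ℕ} (h : Sched Finset.univ fun i => m * α i) :
    InWSP m α := by
  obtain ⟨C, hC⟩ := h
  refine ⟨fun t k => C (m * t + k), fun i t => ?_⟩
  obtain ⟨n, h1, h2, h3⟩ := hC i (Finset.mem_univ i) (m * t)
  have hm : 0 < m := by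
    rcases Nat.eq_zero_or_pos m with rfl | hm
    · simp at h1 h2
    · exact hm
  refine ⟨n / m, (Nat.le_div_iff_mul_le hm).2 (by linarith),
    (Nat.div_lt_iff_lt_mul hm).2 (by linarith), ⟨n % m, Nat.mod_lt n hm⟩, ?_⟩
  simpa [Nat.div_add_mod] using h3

/-- Three windows of density at most `5 / 6` can be scheduled. -/
theorem sched_of_card_eq_three [Nonempty ι] [DecidableEq ι] {s : Finset ι} {α : ι → ℕ}
    (hs : s.card = 3) (hα : ∀ i ∈ s, 1 ≤ α i) (hsum : ∑ i ∈ s, 1 / (α i : ℚ) ≤ 5 / 6) :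
    Sched s α := by
  by_cases h3 : ∀ i ∈ s, 3 ≤ α i
  · exact sched_of_card_le hs.le h3
  push Not at h3
  obtain ⟨i, hi, hlt⟩ := h3
  have hi0 : (0 : ℚ) < α i := by exact_mod_cast hα i hi
  have hcard : (s.erase i).card = 2 := by rw [Finset.card_erase_of_mem hi, hs]
  rw [← Finset.add_sum_erase s _ hi] at hsum
  have hi2 : 1 / 2 ≤ 1 / (α i : ℚ) := by
    refine one_div_le_one_div_of_le hi0 ?_
    exact_mod_cast Nat.lt_succ_iff.1 hlt
  -- Since 1/2 + 1/3 = 5/6, a second window of at most 3 leaves nothing for the third.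
  have h4 : ∀ j ∈ s.erase i, 4 ≤ α j := fun j hj => by
    by_contra hj4
    have hj0 : (0 : ℚ) < α j := by exact_mod_cast hα j (Finset.mem_of_mem_erase hj)
    have hj3 : 1 / 3 ≤ 1 / (α j : ℚ) := by
      refine one_div_le_one_div_of_le hj0 ?_
      exact_mod_cast (show α j ≤ 3 by omega)
    have hpos : 0 < ∑ l ∈ (s.erase i).erase j, 1 / (α l : ℚ) := by
      refine Finset.sum_pos (fun l hl => ?_) (Finset.card_pos.1 ?_)
      · have := hα l (Finset.mem_of_mem_erase (Finset.mem_of_mem_erase hl))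
        positivity
      · rw [Finset.card_erase_of_mem hj, hcard]; norm_num
    rw [← Finset.add_sum_erase _ _ hj] at hsum
    linarith
  have hi2' : 2 ≤ α i := by
    by_contra h1
    have h2 : α i = 1 := by have := hα i hi; omega
    have hnn : 0 ≤ ∑ l ∈ s.erase i, 1 / (α l : ℚ) :=
      Finset.sum_nonneg fun l _ => by positivity
    rw [h2] at hsum
    norm_num at hsum
    norm_num at hnn
    linarith
  -- Every other slot goes to `i`; the other two symbols alternate in the rest, each every four
  -- slots.
  have h := Sched.union (α := α) (r := 1 / 2) (by norm_num) (by norm_num)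
    (sched_of_card_le (s := {i}) (α := fun _ => 1) le_rfl fun _ _ => le_rfl)
    (sched_of_card_le (s := s.erase i) (α := fun _ => 2) hcard.le fun _ _ => le_rfl)
    (fun j hj => by
      rw [Finset.mem_singleton.1 hj]
      have : (2 : ℚ) ≤ α i := by exact_mod_cast hi2'
      push_cast; linarith)
    (fun j hj => by
      have : (4 : ℚ) ≤ α j := by exact_mod_cast h4 j hj
      push_cast; linarith)
  rwa [← Finset.insert_eq, Finset.insert_erase hi] at h

theorem sum_one_div_mul {m q : ℕ} (α : Fin q → ℕ) :
    ∑ i, 1 / ((m * α i : ℕ) : ℚ) = density α / m := by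
  rw [density, Finset.sum_div]
  refine Finset.sum_congr rfl fun i _ => ?_
  push_cast
  rw [div_div, mul_comm]

end WindowsScheduling

theorem mainTheorem5 (m q : ℕ) (α : Fin q → ℕ)
    (hm : 1 ≤ m) (hq : 1 ≤ q) (hα : ∀ i, 1 ≤ α i) :
    (WindowsScheduling.density α ≤ 3 / 4 * (m : ℚ) → WindowsScheduling.InWSP m α) ∧
    (q = 3 → WindowsScheduling.density α ≤ 5 / 6 * (m : ℚ) → WindowsScheduling.InWSP m α) := by
  have : Nonempty (Fin q) := ⟨⟨0, hq⟩⟩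
  have hm0 : (0 : ℚ) < m := by exact_mod_cast hm
  have hpos : ∀ i ∈ Finset.univ, 1 ≤ m * α i := fun i _ => Nat.mul_pos hm (hα i)
  refine ⟨fun h => .of_sched (WindowsScheduling.sched_of_density_le _ _ hpos ?_),
    fun hq3 h => .of_sched (WindowsScheduling.sched_of_card_eq_three (by simp [hq3]) hpos ?_)⟩
  all_goals
    rw [WindowsScheduling.sum_one_div_mul, div_le_iff₀ hm0]
    exact h
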